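/- Let $f,g:\mathbb{R}^n\to(-\infty,\infty]$ and $F:=f+g$. Assume that $f(x)=h(Ax)+\langle q,x\rangle$, where $A\in\mathbb{R}^{m\times n}$, $q\in\mathbb{R}^n$, and $h:\mathbb{R}^m\to(-\infty,\infty]$ is closed (lower semicontinuous), proper and convex, has an open domain $\operatorname{dom}h$, is continuously differentiable on $\operatorname{dom}h$, and is strongly convex on every compact convex subset of $\operatorname{dom}h$ (with a modulus that may depend on the subset). Assume that $g$ is convex and piecewise linear-quadratic, i.e. $\operatorname{dom}g$ is a union of finitely many polyhedral sets, on each of which $g(x)=\tfrac12\langle x,Qx\rangle+\langle a,x\rangle+\alpha$ for some symmetric matrix $Q$, vector $a$ and scalar $\alpha$ (depending on the set). Let $\bar x$ be an optimal solution of $\min_{x\in\mathbb{R}^n}F(x)$, i.e. a global minimizer with $F(\bar x)<\infty$. Then $F$ has the KL property at $\bar x$ with exponent $\tfrac12$: $F$ is proper and lower semicontinuous, and there exist $\kappa,\varepsilon>0$ such that $$\kappa\,\bigl(F(x)-F(\bar x)\bigr)^{-1/2}\operatorname{dist}\bigl(0,\partial F(x)\bigr)\ge 1\qquad\text{for all }x\text{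 with }\|x-\bar x\|<\varepsilon,\ F(\bar x)<F(x)<\infty .$$ Here $\partial F(x)$ is the limiting subdifferential, i.e. the set of all $\xi$ for which there are $x_k\to x$, $\xi_k\to\xi$ with $F(x_k)\to F(x)$ and $\xi_k\in\partial^\pi F(x_k)$ for all $k$, where, for $F(y)$ finite, $\zeta\in\partial^\pi F(y)$ means that for some $\sigma,\eta>0$ one has $F(z)\ge F(y)+\langle\zeta,z-y\rangle-\sigma\|z-y\|^2$ whenever $\|z-y\|<\eta$; and $\operatorname{dist}(0,\emptyset)=\infty$. No compactness of the solution set is assumed. -/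

import Mathlib

open Set Filter Topology

/-- The effective domain of an extended-real-valued function. -/
def effDom {E : Type*} (φ : E → EReal) : Set E := {x | φ x < ⊤}

/-- A proper function: it never takes the value `-∞`, and it is finite somewhere. -/
def IsProperFun {E : Type*} (φ : E → EReal) : Prop :=
  (∀ x, φ x ≠ ⊥) ∧ (effDom φ).Nonempty

/-- Convexity of an extended-real-valued function: its epigraph is a convex set. -/
def IsConvexFun {d : ℕ} (φ : EuclideanSpace ℝ (Fin d) → EReal) : Prop :=
  Convex ℝ {p : EuclideanSpace ℝ (Fin d) × ℝ | φ p.1 ≤ (p.2 : EReal)}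

/-- A global minimizer with finite objective value (`φ` being proper): an optimal solution of
`min φ`. -/
def IsOptimalSolution {E : Type*} (φ : E → EReal) (x : E) : Prop :=
  x ∈ effDom φ ∧ ∀ y, φ x ≤ φ y

/-- The structured assumption: `f x = h (A x) + ⟪q, x⟫` with `h` closed, proper and convex,
`dom h` open, `h` continuously differentiable on `dom h`, and `h` strongly convex on every compact
convex subset of `dom h` (with a modulus that may depend on the subset). -/
def StructuredAssumption {n : ℕ} (f : EuclideanSpace ℝ (Fin n) → EReal) : Prop :=
  ∃ (m : ℕ) (A : Matrix (Fin m) (Fin n) ℝ) (q : EuclideanSpace ℝ (Fin n))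
    (h : EuclideanSpace ℝ (Fin m) → EReal),
    IsProperFun h ∧ LowerSemicontinuous h ∧ IsConvexFun h ∧
    IsOpen (effDom h) ∧
    ContDiffOn ℝ 1 (fun y => (h y).toReal) (effDom h) ∧
    (∀ K : Set (EuclideanSpace ℝ (Fin m)), K ⊆ effDom h → IsCompact K → Convex ℝ K →
      ∃ σ : ℝ, 0 < σ ∧ StrongConvexOn K σ (fun y => (h y).toReal)) ∧
    ∀ x, f x = h (A.toEuclideanLin x) + ((inner ℝ q x : ℝ) : EReal)

/-- A polyhedral (convex) set: a finite intersection of closed half-spaces. -/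
def IsPolyhedralSet {n : ℕ} (C : Set (EuclideanSpace ℝ (Fin n))) : Prop :=
  ∃ (k : ℕ) (b : Fin k → EuclideanSpace ℝ (Fin n)) (β : Fin k → ℝ),
    C = {x | ∀ i, inner ℝ (b i) x ≤ β i}

/-- Piecewise linear-quadratic functions: the effective domain is a union of finitely many
polyhedral sets, relative to each of which the function is given by
`½ ⟪x, Q x⟫ + ⟪a, x⟫ + α` with `Q` symmetric. -/
def IsPiecewiseLinearQuadratic {n : ℕ} (g : EuclideanSpace ℝ (Fin n) → EReal) : Prop :=
  ∃ (N : ℕ) (C : Fin N → Set (EuclideanSpace ℝ (Fin n)))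
    (Q : Fin N → Matrix (Fin n) (Fin n) ℝ) (a : Fin N → EuclideanSpace ℝ (Fin n))
    (α : Fin N → ℝ),
    (∀ i, IsPolyhedralSet (C i)) ∧ (∀ i, (Q i).IsSymm) ∧
    effDom g = ⋃ i, C i ∧
    ∀ i, ∀ x ∈ C i,
      g x = ((1 / 2 * inner ℝ x ((Q i).toEuclideanLin x) + inner ℝ (a i) x + α i : ℝ) : EReal)

/-- The proximal subdifferential at `x₀` (empty where `φ` is not finite). -/
def proximalSubdifferential {d : ℕ} (φ : EuclideanSpace ℝ (Fin d) → EReal)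
    (x₀ : EuclideanSpace ℝ (Fin d)) : Set (EuclideanSpace ℝ (Fin d)) :=
  {ξ | φ x₀ ≠ ⊥ ∧ φ x₀ ≠ ⊤ ∧ ∃ σ : ℝ, 0 < σ ∧ ∃ η : ℝ, 0 < η ∧ ∀ x ∈ Metric.ball x₀ η,
    φ x₀ + ((inner ℝ ξ (x - x₀) - σ * ‖x - x₀‖ ^ 2 : ℝ) : EReal) ≤ φ x}

/-- The limiting (Mordukhovich) subdifferential at `x₀` (empty where `φ` is not finite). -/
def limitingSubdifferential {d : ℕ} (φ : EuclideanSpace ℝ (Fin d) → EReal)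
    (x₀ : EuclideanSpace ℝ (Fin d)) : Set (EuclideanSpace ℝ (Fin d)) :=
  {ξ | φ x₀ ≠ ⊥ ∧ φ x₀ ≠ ⊤ ∧
    ∃ (x : ℕ → EuclideanSpace ℝ (Fin d)) (v : ℕ → EuclideanSpace ℝ (Fin d)),
      Tendsto x atTop (𝓝 x₀) ∧ Tendsto v atTop (𝓝 ξ) ∧
      (∀ k, v k ∈ proximalSubdifferential φ (x k)) ∧
      Tendsto (fun k => φ (x k)) atTop (𝓝 (φ x₀))}

/-- The KL property with exponent `1/2` at `xbar`, for a proper closed function `φ` and a point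
`xbar` of its domain: there are `κ, ε > 0` such that
`κ (φ x - φ xbar) ^ (-1/2) * dist (0, ∂φ x) ≥ 1` whenever `‖x - xbar‖ < ε` and
`φ xbar < φ x < ∞`. The distance to the empty set is `∞`. -/
def HasKLPropertyHalf {d : ℕ} (φ : EuclideanSpace ℝ (Fin d) → EReal)
    (xbar : EuclideanSpace ℝ (Fin d)) : Prop :=
  IsProperFun φ ∧ LowerSemicontinuous φ ∧ xbar ∈ effDom φ ∧
  ∃ κ : ℝ, 0 < κ ∧ ∃ ε : ℝ, 0 < ε ∧
    ∀ x ∈ Metric.ball xbar ε, φ xbar < φ x → φ x < ⊤ →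
      1 ≤ ENNReal.ofReal (κ * (φ x - φ xbar).toReal ^ (-(1 / 2) : ℝ)) *
        Metric.infEDist 0 (limitingSubdifferential φ x)

/-! The KL inequality with exponent 1/2 follows from convexity and quadratic growth: near `xbar`,
every `x` in the domain has a global minimizer `z` with `F x - F xbar ≥ c‖x - z‖²`. A subgradient
`ξ` at `x` satisfies `F x - F xbar ≤ ‖ξ‖ ‖x - z‖`, and eliminating `‖x - z‖` gives `‖ξ‖² ≥ c (F x -
F xbar)`.

For the growth, linearize `f` at `xbar`, with derivative `l`. First-order optimality makes `G x = g
x - g xbar + l (x - xbar)` nonnegative on `dom g`, and strong convexity of `h` on a ball around `A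
xbar` gives `F x - F xbar ≥ σ/2 ‖A (x - xbar)‖² + G x`. On a polyhedral piece containing `xbar`, `G`
is a nonnegative convex quadratic vanishing there. Finitely many linear equations on that piece
force `G z = 0` and `A z = A xbar`, hence minimality, and their squared residuals are bounded by a
multiple of `‖A (x - xbar)‖² + G x`. The Hoffman bound `exists_slice_dist_le` turns residuals into
distance. No compactness of the solution set enters, since only points near `xbar` are estimated. -/

/-! ### Error bounds and quadratic growth on one polyhedron -/

/-- A Hoffman-type error bound: relative to a polyhedron, the distance to the slice cut out by a
linear equation is controlled by the residual of the equation. -/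
theorem exists_slice_dist_le {E F ι : Type*} [NormedAddCommGroup E] [InnerProductSpace ℝ E]
    [FiniteDimensional ℝ E] [NormedAddCommGroup F] [NormedSpace ℝ F] [Fintype ι]
    (b : ι → E →L[ℝ] ℝ) (β : ι → ℝ) (L : E →L[ℝ] F) (x₀ : E) (hx₀ : ∀ i, b i x₀ ≤ β i) :
    ∃ c : ℝ, 0 < c ∧ ∀ x, (∀ i, b i x ≤ β i) →
      ∃ z, (∀ i, b i z ≤ β i) ∧ L z = L x₀ ∧ c * ‖x - z‖ ≤ ‖L x - L x₀‖ := by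
  classical
  -- `J` plays the role of an active set: `u` lies in its cone and in the polar of that cone
  -- intersected with `ker L`. There are finitely many `J`, so one constant will serve all.
  have key : ∀ J : Finset ι, ∃ c : ℝ, 0 < c ∧ ∀ u : E, (∀ i ∈ J, b i u ≤ 0) →
      (∀ w, (∀ i ∈ J, b i w ≤ 0) → L w = 0 → inner ℝ u w ≤ 0) → c * ‖u‖ ≤ ‖L u‖ := by
    intro J
    set S : Set E := Metric.sphere 0 1 ∩ ({u | ∀ i ∈ J, b i u ≤ 0} ∩
      {u | ∀ w, (∀ i ∈ J, b i w ≤ 0) → L w = 0 → inner ℝ u w ≤ 0}) with hS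
    have hcomp : IsCompact S := by
      refine (isCompact_sphere (0 : E) 1).inter_right (IsClosed.inter ?_ ?_)
      · simp only [ofPred_forall]
        exact isClosed_iInter fun i => isClosed_iInter fun _ =>
          isClosed_le (b i).continuous continuous_const
      · simp only [ofPred_forall]
        exact isClosed_iInter fun w => isClosed_iInter fun _ => isClosed_iInter fun _ =>
          isClosed_le (by fun_prop) continuous_const
    obtain ⟨c, hc, hcS⟩ := hcomp.exists_forall_le' (f := fun u => ‖L u‖) (a := 0)
      (by fun_prop) (by
        rintro u ⟨hu1, hu2, hu3⟩
        refine norm_pos_iff.2 fun h0 => ?_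
        -- If `L u = 0`, the polar condition may be tested at `u` itself, forcing `‖u‖² ≤ 0`.
        have h1 := hu3 u hu2 h0
        rw [real_inner_self_eq_norm_sq, mem_sphere_zero_iff_norm.1 hu1] at h1
        norm_num at h1)
    refine ⟨c, hc, fun u hu hpol => ?_⟩
    rcases eq_or_ne u 0 with rfl | hne
    · simp
    have hpos : 0 < ‖u‖ := norm_pos_iff.2 hne
    have hinv : 0 ≤ ‖u‖⁻¹ := (inv_pos.2 hpos).le
    have h2 := hcS (‖u‖⁻¹ • u) ⟨by simp [norm_smul, hpos.ne'],
      fun i hi => by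
        simpa using mul_nonpos_of_nonneg_of_nonpos hinv (hu i hi),
      fun w hw hw0 => by
        rw [real_inner_smul_left]
        exact mul_nonpos_of_nonneg_of_nonpos hinv (hpol w hw hw0)⟩
    simp only [map_smul, norm_smul, norm_inv, norm_norm] at h2
    rwa [← div_eq_inv_mul, le_div_iff₀ hpos] at h2
  choose c hc hcJ using key
  obtain ⟨J₀, -, hJ₀⟩ := Finset.exists_min_image (Finset.univ : Finset (Finset ι)) c
    Finset.univ_nonempty
  refine ⟨c J₀, hc J₀, fun x hx => ?_⟩
  set P : Set E := {x | ∀ i, b i x ≤ β i} ∩ {x | L x = L x₀} with hP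
  have hPclosed : IsClosed P := by
    refine IsClosed.inter ?_ (isClosed_eq L.continuous continuous_const)
    simp only [ofPred_forall]
    exact isClosed_iInter fun i => isClosed_le (b i).continuous continuous_const
  have hPconv : Convex ℝ P := by
    rintro y ⟨hy, hyL⟩ z ⟨hz, hzL⟩ s t hs ht hst
    refine ⟨fun i => ?_, ?_⟩
    · have h1 := mul_le_mul_of_nonneg_left (hy i) hs
      have h2 := mul_le_mul_of_nonneg_left (hz i) ht
      simp only [map_add, map_smul, smul_eq_mul]
      calc _ ≤ s * β i + t * β i := add_le_add h1 h2
        _ = β i := by rw [← add_mul, hst, one_mul]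
    · simp only [mem_ofPred_eq] at hyL hzL ⊢
      rw [map_add, map_smul, map_smul, hyL, hzL, ← add_smul, hst, one_smul]
  obtain ⟨z, hzP, hz⟩ := exists_norm_eq_iInf_of_complete_convex
    (show P.Nonempty from ⟨x₀, hx₀, rfl⟩)
    hPclosed.isComplete hPconv x
  rw [norm_eq_iInf_iff_real_inner_le_zero hPconv hzP] at hz
  refine ⟨z, hzP.1, hzP.2, ?_⟩
  -- With `z` the projection of `x` onto the slice, `key` applies to `x - z` and the constraints
  -- active at `z`. Inactive ones are strict, so every admissible `w` is a feasible direction for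
  -- small steps.
  set J : Finset ι := Finset.univ.filter fun i => b i z = β i with hJ
  have h1 := hcJ J (x - z)
    (fun i hi => by
      have : b i z = β i := by simpa [hJ] using hi
      rw [map_sub, this]; linarith [hx i])
    (fun w hw hw0 => by
      have hev : ∀ᶠ t : ℝ in 𝓝[>] 0, ∀ i, b i (z + t • w) ≤ β i := by
        rw [eventually_all]
        intro i
        by_cases hi : b i z = β i
        · filter_upwards [self_mem_nhdsWithin] with t ht
          have hw' := hw i (by simp [hJ, hi])
          rw [map_add, map_smul, smul_eq_mul, hi]
          nlinarith [mem_Ioi.1 ht]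
        · have hlt : b i z < β i := lt_of_le_of_ne (hzP.1 i) hi
          have hcont : Continuous fun t : ℝ => b i (z + t • w) := by fun_prop
          have : ∀ᶠ t : ℝ in 𝓝 0, b i (z + t • w) < β i :=
            hcont.continuousAt.eventually_lt continuousAt_const (by simpa using hlt)
          exact (this.filter_mono nhdsWithin_le_nhds).mono fun t ht => ht.le
      obtain ⟨t, ht, ht0⟩ := (hev.and self_mem_nhdsWithin).exists
      have h2 := hz (z + t • w) ⟨ht, by
        simp only [mem_ofPred_eq]
        rw [map_add, map_smul, hw0, smul_zero, add_zero]; exact hzP.2⟩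
      rw [add_sub_cancel_left, real_inner_smul_right] at h2
      exact nonpos_of_mul_nonpos_right h2 ht0)
  rw [map_sub, show L z = L x₀ from hzP.2] at h1
  exact (mul_le_mul_of_nonneg_right (hJ₀ J (Finset.mem_univ _)) (norm_nonneg _)).trans h1

/-- A positive semidefinite symmetric operator satisfies `‖M d‖² ≤ K ⟪d, M d⟫`. -/
theorem exists_norm_sq_map_le_inner {E : Type*} [NormedAddCommGroup E] [InnerProductSpace ℝ E]
    (M : E →L[ℝ] E) (hsymm : ∀ x y, inner ℝ (M x) y = inner ℝ x (M y))
    (hpos : ∀ x, 0 ≤ inner ℝ x (M x)) :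
    ∃ K : ℝ, 0 < K ∧ ∀ d, ‖M d‖ ^ 2 ≤ K * inner ℝ d (M d) := by
  refine ⟨‖M‖ + 1, by positivity, fun d => ?_⟩
  set K := ‖M‖ + 1 with hK
  have hK0 : 0 < K := by positivity
  -- Expanding gives `0 ≤ K²⟪d, M d⟫ - 2K‖M d‖² + ⟪M d, M (M d)⟫`, whose last term is at most `K‖M
  -- d‖²`.
  have h1 := hpos (K • d - M d)
  have h2 : inner ℝ (M d) (M (M d)) ≤ K * ‖M d‖ ^ 2 := by
    calc inner ℝ (M d) (M (M d)) ≤ ‖M d‖ * ‖M (M d)‖ := real_inner_le_norm _ _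
      _ ≤ ‖M d‖ * (‖M‖ * ‖M d‖) := by gcongr; exact M.le_opNorm _
      _ ≤ K * ‖M d‖ ^ 2 := by nlinarith [sq_nonneg ‖M d‖]
  have h3 : inner ℝ d (M (M d)) = ‖M d‖ ^ 2 := by
    rw [← hsymm, real_inner_self_eq_norm_sq]
  simp only [map_sub, map_smul, inner_sub_left, inner_sub_right, real_inner_smul_left,
    real_inner_smul_right, real_inner_self_eq_norm_sq, h3] at h1
  nlinarith

/-- If `φ t ≤ φ 0 + a t + b t²` for small positive `t`, then `φ' 0 ≤ a`. -/
theorem HasDerivAt.le_of_eventually_le {φ : ℝ → ℝ} {φ' a b : ℝ} (hφ : HasDerivAt φ φ' 0)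
    (h : ∀ᶠ t in 𝓝[>] (0 : ℝ), φ t ≤ φ 0 + t * a + t ^ 2 * b) : φ' ≤ a := by
  have h1 : Tendsto (fun t : ℝ => t⁻¹ • (φ (0 + t) - φ 0)) (𝓝[>] 0) (𝓝 φ') :=
    hφ.tendsto_slope_zero_right
  have h2 : Tendsto (fun t : ℝ => a + t * b) (𝓝[>] 0) (𝓝 a) := by
    have : Continuous fun t : ℝ => a + t * b := by fun_prop
    simpa using (this.tendsto 0).mono_left nhdsWithin_le_nhds
  refine le_of_tendsto_of_tendsto h1 h2 ?_
  filter_upwards [h, self_mem_nhdsWithin] with t ht ht0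
  have ht0 : 0 < t := ht0
  rw [zero_add, smul_eq_mul, inv_mul_le_iff₀ ht0]
  nlinarith

/-- Quadratic growth of a nonnegative quadratic function, convex on a polyhedron, at a zero. -/
theorem exists_quadratic_growth_on_polyhedron {E F ι : Type*} [NormedAddCommGroup E]
    [InnerProductSpace ℝ E] [FiniteDimensional ℝ E] [NormedAddCommGroup F] [NormedSpace ℝ F]
    [Fintype ι] (b : ι → E →L[ℝ] ℝ) (β : ι → ℝ) (A : E →L[ℝ] F) (x₀ : E)
    (hx₀ : ∀ i, b i x₀ ≤ β i) (Q : E →L[ℝ] E)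
    (hQ : ∀ x y, inner ℝ (Q x) y = inner ℝ x (Q y)) (l : E →L[ℝ] ℝ) (α : ℝ) (G : E → ℝ)
    (hG : ∀ x, (∀ i, b i x ≤ β i) → G x = 1 / 2 * inner ℝ x (Q x) + l x + α)
    (hG_conv : ConvexOn ℝ {x | ∀ i, b i x ≤ β i} G)
    (hG_nonneg : ∀ x, (∀ i, b i x ≤ β i) → 0 ≤ G x) (hG₀ : G x₀ = 0) :
    ∃ c : ℝ, 0 < c ∧ ∀ x, (∀ i, b i x ≤ β i) → ‖x - x₀‖ ≤ 1 →
      ∃ z, (∀ i, b i z ≤ β i) ∧ A z = A x₀ ∧ G z = 0 ∧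
        c * ‖x - z‖ ^ 2 ≤ ‖A (x - x₀)‖ ^ 2 + G x := by
  set C : Set E := {x | ∀ i, b i x ≤ β i} with hC
  have hx₀C : x₀ ∈ C := hx₀
  have hconv : Convex ℝ C := hG_conv.1
  set p : E →L[ℝ] ℝ := innerSL ℝ (Q x₀) + l with hp
  have hexp : ∀ x ∈ C, G x = p (x - x₀) + 1 / 2 * inner ℝ (x - x₀) (Q (x - x₀)) := by
    intro x hx
    have h0 := hG x₀ hx₀
    rw [hG₀] at h0
    rw [hG x hx]
    have h1 := hQ x₀ x
    have h2 := hQ x₀ x₀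
    simp only [hp, _root_.add_apply, innerSL_apply_apply, map_sub, inner_sub_left,
      inner_sub_right]
    have h3 := real_inner_comm x (Q x₀)
    linarith
  -- Midpoint convexity of a quadratic says exactly that its form is nonnegative on differences.
  have hdiff : ∀ x ∈ C, ∀ y ∈ C, 0 ≤ inner ℝ (x - y) (Q (x - y)) := by
    intro x hx y hy
    have h1 := hG_conv.2 hx hy (by norm_num : (0 : ℝ) ≤ 1 / 2) (by norm_num : (0 : ℝ) ≤ 1 / 2)
      (by norm_num)
    have h2 := hconv hx hy (by norm_num : (0 : ℝ) ≤ 1 / 2) (by norm_num : (0 : ℝ) ≤ 1 / 2)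
      (by norm_num)
    rw [hG _ h2, hG x hx, hG y hy] at h1
    simp only [map_add, map_smul, map_sub, inner_add_left, inner_add_right, inner_sub_left,
      inner_sub_right, real_inner_smul_left, real_inner_smul_right, smul_eq_mul] at h1 ⊢
    linarith
  -- `Q` need be positive semidefinite only along `V`, the directions spanned by `C - x₀`.
  -- Compressing it to `V` gives an operator `M` that is so on all of `E` and has the same form on
  -- `C - x₀`.
  set V : Submodule ℝ E := Submodule.span ℝ ((fun x => x - x₀) '' C) with hV
  have hspan : ∀ v ∈ V, ∃ s : ℝ, 0 ≤ s ∧ ∃ x ∈ C, ∃ y ∈ C, v = s • (x - y) := by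
    intro v hv
    induction hv using Submodule.span_induction with
    | mem v hv =>
      obtain ⟨x, hx, rfl⟩ := hv
      exact ⟨1, zero_le_one, x, hx, x₀, hx₀C, by simp⟩
    | zero => exact ⟨0, le_rfl, x₀, hx₀C, x₀, hx₀C, by simp⟩
    | add v w _ _ hv hw =>
      obtain ⟨s, hs, x, hx, y, hy, rfl⟩ := hv
      obtain ⟨t, ht, x', hx', y', hy', rfl⟩ := hw
      rcases eq_or_lt_of_le (add_nonneg hs ht) with h0 | h0
      · have hs0 : s = 0 := by linarith
        have ht0 : t = 0 := by linarith
        exact ⟨0, le_rfl, x₀, hx₀C, x₀, hx₀C, by simp [hs0, ht0]⟩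
      · refine ⟨s + t, h0.le, (s / (s + t)) • x + (t / (s + t)) • x',
          hconv hx hx' (by positivity) (by positivity) (by field_simp),
          (s / (s + t)) • y + (t / (s + t)) • y',
          hconv hy hy' (by positivity) (by positivity) (by field_simp), ?_⟩
        have e1 : (s + t) * (s / (s + t)) = s := by field_simp
        have e2 : (s + t) * (t / (s + t)) = t := by field_simp
        simp only [smul_sub, smul_add, smul_smul, e1, e2]
        abel
    | smul r v _ hv =>
      obtain ⟨s, hs, x, hx, y, hy, rfl⟩ := hv
      rcases le_total 0 r with hr | hr
      · exact ⟨r * s, mul_nonneg hr hs, x, hx, y, hy, by rw [smul_smul]⟩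
      · refine ⟨-r * s, mul_nonneg (neg_nonneg.2 hr) hs, y, hy, x, hx, ?_⟩
        rw [smul_smul, ← neg_sub y x, smul_neg, neg_mul, neg_smul]
  have hVpos : ∀ v ∈ V, 0 ≤ inner ℝ v (Q v) := by
    intro v hv
    obtain ⟨s, hs, x, hx, y, hy, rfl⟩ := hspan v hv
    rw [map_smul, real_inner_smul_left, real_inner_smul_right]
    exact mul_nonneg hs (mul_nonneg hs (hdiff x hx y hy))
  set M : E →L[ℝ] E := V.starProjection ∘L Q ∘L V.starProjection with hM
  have hstar : ∀ x y, inner ℝ (V.starProjection x) y = inner ℝ x (V.starProjection y) :=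
    fun x y => Submodule.inner_starProjection_left_eq_right V x y
  have hMinner : ∀ x y, inner ℝ x (M y) = inner ℝ (V.starProjection x) (Q (V.starProjection y)) :=
    fun x y => (hstar x _).symm
  have hMV : ∀ x ∈ C, inner ℝ (x - x₀) (M (x - x₀)) = inner ℝ (x - x₀) (Q (x - x₀)) := by
    intro x hx
    have : V.starProjection (x - x₀) = x - x₀ :=
      Submodule.starProjection_eq_self_iff.2 (Submodule.subset_span ⟨x, hx, rfl⟩)
    rw [hMinner, this]
  obtain ⟨K, hK, hKM⟩ := exists_norm_sq_map_le_inner M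
    (fun x y => by rw [hMinner, ← hQ]; exact hstar _ _)
    (fun x => by rw [hMinner]; exact hVpos _ (Submodule.starProjection_apply_mem V x))
  have hp_nonneg : ∀ x ∈ C, 0 ≤ p (x - x₀) := by
    intro x hx
    have hder : HasDerivAt (fun t : ℝ => t * (-p (x - x₀))) (-p (x - x₀)) 0 := by
      simpa using (hasDerivAt_id (0 : ℝ)).mul_const (-p (x - x₀))
    have := hder.le_of_eventually_le (a := 0) (b := 1 / 2 * inner ℝ (x - x₀) (Q (x - x₀))) (by
      filter_upwards [Ioo_mem_nhdsGT (zero_lt_one' ℝ)] with t ht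
      have hmem : x₀ + t • (x - x₀) ∈ C := hconv.add_smul_sub_mem hx₀C hx ⟨ht.1.le, ht.2.le⟩
      have h1 := hG_nonneg _ hmem
      rw [hexp _ hmem, add_sub_cancel_left] at h1
      simp only [map_smul, real_inner_smul_left, real_inner_smul_right, smul_eq_mul] at h1
      nlinarith)
    linarith
  -- On the slice through `x₀` both the linear part `p` and the quadratic part `M` of `G` vanish,
  -- and `A` is constant.
  obtain ⟨c, hc, hslice⟩ := exists_slice_dist_le b β (p.prod (M.prod A)) x₀ hx₀
  -- With `d = x - x₀`, the three residuals satisfy `(p d)² ≤ ‖p‖ p d` (as `‖d‖ ≤ 1`), `‖M d‖² ≤ 2K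
  -- · ½⟪d, M d⟫`, and `‖A d‖²` with factor 1; `R` dominates all three factors.
  set R : ℝ := ‖p‖ + 2 * K + 1 with hR
  have hR0 : 0 < R := by positivity
  refine ⟨c ^ 2 / R, by positivity, fun x hx hx1 => ?_⟩
  obtain ⟨z, hz, hzL, hzle⟩ := hslice x hx
  simp only [ContinuousLinearMap.prod_apply, Prod.mk.injEq] at hzL
  obtain ⟨hz1, hz2, hz3⟩ := hzL
  refine ⟨z, hz, hz3, ?_, ?_⟩
  · rw [hexp z hz, ← hMV z hz]
    simp [map_sub, hz1, hz2]
  · have hpd := hp_nonneg x hx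
    have hMd : 0 ≤ inner ℝ (x - x₀) (M (x - x₀)) := by
      rw [hMV x hx]; exact hdiff x hx x₀ hx₀C
    have hGx := hexp x hx
    rw [← hMV x hx] at hGx
    have hKd := hKM (x - x₀)
    have hple : p (x - x₀) ≤ ‖p‖ := by
      calc p (x - x₀) ≤ ‖p (x - x₀)‖ := le_abs_self _
        _ ≤ ‖p‖ * ‖x - x₀‖ := p.le_opNorm _
        _ ≤ ‖p‖ := mul_le_of_le_one_right (norm_nonneg _) hx1
    have hp2 : p (x - x₀) ^ 2 ≤ ‖p‖ * p (x - x₀) := by nlinarith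
    have hGx0 : 0 ≤ G x := hG_nonneg x hx
    have hT : 0 ≤ ‖A (x - x₀)‖ ^ 2 + G x := by positivity
    have hsq : (c * ‖x - z‖) ^ 2 ≤ R * (‖A (x - x₀)‖ ^ 2 + G x) := by
      have hmax : ‖(p.prod (M.prod A)) x - (p.prod (M.prod A)) x₀‖ =
          max ‖p (x - x₀)‖ (max ‖M (x - x₀)‖ ‖A (x - x₀)‖) := by
        rw [← map_sub]; rfl
      rw [hmax] at hzle
      have hpn := norm_nonneg p
      have hAn := sq_nonneg ‖A (x - x₀)‖
      have hzn : 0 ≤ c * ‖x - z‖ := by positivity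
      rcases le_max_iff.1 hzle with h | h
      · have h' := pow_le_pow_left₀ hzn h 2
        rw [Real.norm_eq_abs, sq_abs] at h'
        have : ‖p‖ * p (x - x₀) ≤ ‖p‖ * (‖A (x - x₀)‖ ^ 2 + G x) := by
          apply mul_le_mul_of_nonneg_left _ hpn; linarith
        nlinarith
      rcases le_max_iff.1 h with h | h
      · have h' := pow_le_pow_left₀ hzn h 2
        have : 2 * K * (1 / 2 * inner ℝ (x - x₀) (M (x - x₀))) ≤
            2 * K * (‖A (x - x₀)‖ ^ 2 + G x) := by
          apply mul_le_mul_of_nonneg_left _ (by positivity); linarith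
        nlinarith
      · have h' := pow_le_pow_left₀ hzn h 2
        nlinarith
    rw [div_mul_eq_mul_div, div_le_iff₀ hR0, ← mul_pow]
    linarith

/-! ### Subgradients of convex functions -/

theorem IsConvexFun.le_combo {d : ℕ} {φ : EuclideanSpace ℝ (Fin d) → EReal} (hφ : IsConvexFun φ)
    {x y : EuclideanSpace ℝ (Fin d)} {r s a b : ℝ} (hx : φ x ≤ r) (hy : φ y ≤ s) (ha : 0 ≤ a)
    (hb : 0 ≤ b) (hab : a + b = 1) : φ (a • x + b • y) ≤ ((a * r + b * s : ℝ) : EReal) := by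
  have h := hφ (x := (x, r)) (y := (y, s)) hx hy ha hb hab
  exact h

/-- Along the segment from `x` to `z` the proximal error is of second order in the step, so
convexity makes the local inequality global. -/
theorem IsConvexFun.toReal_add_inner_le_of_mem_proximalSubdifferential {d : ℕ}
    {φ : EuclideanSpace ℝ (Fin d) → EReal} (hφ : IsConvexFun φ)
    {x z ξ : EuclideanSpace ℝ (Fin d)} (hξ : ξ ∈ proximalSubdifferential φ x) {s : ℝ}
    (hz : φ z = s) : (φ x).toReal + inner ℝ ξ (z - x) ≤ s := by
  obtain ⟨hbot, htop, σ, hσ, η, hη, h⟩ := hξ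
  lift φ x to ℝ using ⟨htop, hbot⟩ with r hr
  have hder : HasDerivAt (fun t : ℝ => t * inner ℝ ξ (z - x)) (inner ℝ ξ (z - x)) 0 := by
    simpa using (hasDerivAt_id (0 : ℝ)).mul_const (inner ℝ ξ (z - x))
  have hball : ∀ᶠ t : ℝ in 𝓝[>] 0, (1 - t) • x + t • z ∈ Metric.ball x η := by
    have hc : Continuous fun t : ℝ => (1 - t) • x + t • z := by fun_prop
    exact (hc.continuousAt.eventually_mem (by
      simpa using Metric.ball_mem_nhds x hη)).filter_mono nhdsWithin_le_nhds
  have := hder.le_of_eventually_le (a := s - r) (b := σ * ‖z - x‖ ^ 2) (by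
    filter_upwards [hball, Ioo_mem_nhdsGT (zero_lt_one' ℝ)] with t ht ht1
    have h1 := (h _ ht).trans (hφ.le_combo hr.ge hz.le (sub_nonneg.2 ht1.2.le) ht1.1.le (by ring))
    have e : (1 - t) • x + t • z - x = t • (z - x) := by
      rw [sub_smul, one_smul, smul_sub]; abel
    rw [e, ← EReal.coe_add, EReal.coe_le_coe_iff, real_inner_smul_right, norm_smul, mul_pow,
      Real.norm_eq_abs, sq_abs] at h1
    linarith)
  simp only [EReal.toReal_coe]
  linarith

theorem IsConvexFun.toReal_add_inner_le_of_mem_limitingSubdifferential {d : ℕ}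
    {φ : EuclideanSpace ℝ (Fin d) → EReal} (hφ : IsConvexFun φ)
    {x z ξ : EuclideanSpace ℝ (Fin d)} (hξ : ξ ∈ limitingSubdifferential φ x) {s : ℝ}
    (hz : φ z = s) : (φ x).toReal + inner ℝ ξ (z - x) ≤ s := by
  obtain ⟨hbot, htop, u, v, hu, hv, hprox, hlim⟩ := hξ
  have h1 : Tendsto (fun k => (φ (u k)).toReal + inner ℝ (v k) (z - u k)) atTop
      (𝓝 ((φ x).toReal + inner ℝ ξ (z - x))) :=
    ((EReal.tendsto_toReal htop hbot).comp hlim).add (hv.inner (tendsto_const_nhds.sub hu))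
  exact le_of_tendsto' h1 fun k =>
    hφ.toReal_add_inner_le_of_mem_proximalSubdifferential (hprox k) hz

/-! ### Piecewise linear-quadratic functions -/

theorem IsPiecewiseLinearQuadratic.ne_bot {n : ℕ} {g : EuclideanSpace ℝ (Fin n) → EReal}
    (hg : IsPiecewiseLinearQuadratic g) (x : EuclideanSpace ℝ (Fin n)) : g x ≠ ⊥ := by
  obtain ⟨N, C, Q, a, α, -, -, hdom, hval⟩ := hg
  intro h
  have hx : x ∈ effDom g := by simp [effDom, h]
  rw [hdom, mem_iUnion] at hx
  obtain ⟨i, hi⟩ := hx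
  rw [hval i x hi] at h
  exact EReal.coe_ne_bot _ h

theorem IsPolyhedralSet.isClosed {n : ℕ} {C : Set (EuclideanSpace ℝ (Fin n))}
    (hC : IsPolyhedralSet C) : IsClosed C := by
  obtain ⟨k, b, β, rfl⟩ := hC
  simp only [ofPred_forall]
  exact isClosed_iInter fun i => isClosed_le (by fun_prop) continuous_const

theorem IsPiecewiseLinearQuadratic.lowerSemicontinuous {n : ℕ}
    {g : EuclideanSpace ℝ (Fin n) → EReal} (hg : IsPiecewiseLinearQuadratic g) :
    LowerSemicontinuous g := by
  obtain ⟨N, C, Q, a, α, hC, -, hdom, hval⟩ := hg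
  intro x y hy
  have key : ∀ i, ∀ᶠ x' in 𝓝 x, x' ∈ C i → y < g x' := by
    intro i
    by_cases hx : x ∈ C i
    · have hcont : Continuous fun x => ((1 / 2 * inner ℝ x ((Q i).toEuclideanLin x) +
          inner ℝ (a i) x + α i : ℝ) : EReal) := by
        have : Continuous (Q i).toEuclideanLin := LinearMap.continuous_of_finiteDimensional _
        exact continuous_coe_real_ereal.comp (by fun_prop)
      rw [hval i x hx] at hy
      filter_upwards [hcont.continuousAt.eventually_mem (Ioi_mem_nhds hy)] with x' hx' hmem
      rw [hval i x' hmem]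
      exact hx'
    · filter_upwards [(hC i).isClosed.isOpen_compl.mem_nhds hx] with x' hx' hmem
      exact absurd hmem hx'
  filter_upwards [eventually_all.2 key] with x' hx'
  by_cases hmem : x' ∈ effDom g
  · rw [hdom, mem_iUnion] at hmem
    obtain ⟨i, hi⟩ := hmem
    exact hx' i hi
  · have : g x' = ⊤ := by simpa [effDom] using hmem
    rw [this]
    exact hy.trans_le le_top

theorem IsConvexFun.convexOn_toReal {d : ℕ} {φ : EuclideanSpace ℝ (Fin d) → EReal}
    (hφ : IsConvexFun φ) (hbot : ∀ x, φ x ≠ ⊥) : ConvexOn ℝ (effDom φ) fun x => (φ x).toReal := by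
  have hcoe : ∀ x ∈ effDom φ, φ x = ((φ x).toReal : EReal) := fun x hx =>
    (EReal.coe_toReal (ne_of_lt hx) (hbot x)).symm
  refine ⟨fun x hx y hy a b ha hb hab => ?_, fun x hx y hy a b ha hb hab => ?_⟩
  · exact (hφ.le_combo (hcoe x hx).le (hcoe y hy).le ha hb hab).trans_lt (EReal.coe_lt_top _)
  · exact (EReal.toReal_le_toReal (hφ.le_combo (hcoe x hx).le (hcoe y hy).le ha hb hab)
      (hbot _) (EReal.coe_ne_top _)).trans_eq (EReal.toReal_coe _)

/-- Pieces missing `x₀` are closed and so avoid a neighbourhood of it. On the finitely many others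
the polyhedral estimate applies, and the least constant works. -/
theorem IsPiecewiseLinearQuadratic.exists_quadratic_growth {n : ℕ} {F : Type*}
    [NormedAddCommGroup F] [NormedSpace ℝ F] {g : EuclideanSpace ℝ (Fin n) → EReal}
    (hg : IsPiecewiseLinearQuadratic g) (hconv : IsConvexFun g)
    (A : EuclideanSpace ℝ (Fin n) →L[ℝ] F) (l : EuclideanSpace ℝ (Fin n) →L[ℝ] ℝ)
    (x₀ : EuclideanSpace ℝ (Fin n)) (hx₀ : x₀ ∈ effDom g)
    (hmin : ∀ x ∈ effDom g, 0 ≤ (g x).toReal - (g x₀).toReal + l (x - x₀)) :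
    ∃ c : ℝ, 0 < c ∧ ∀ᶠ x in 𝓝 x₀, x ∈ effDom g → ∃ z ∈ effDom g, A z = A x₀ ∧
      (g z).toReal - (g x₀).toReal + l (z - x₀) = 0 ∧
      c * ‖x - z‖ ^ 2 ≤ ‖A (x - x₀)‖ ^ 2 + ((g x).toReal - (g x₀).toReal + l (x - x₀)) := by
  have hgconv := hconv.convexOn_toReal hg.ne_bot
  obtain ⟨N, C, Q, a, α, hC, hQ, hdom, hval⟩ := hg
  set G : EuclideanSpace ℝ (Fin n) → ℝ := fun x => (g x).toReal - (g x₀).toReal + l (x - x₀)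
    with hG
  have key : ∀ i, ∃ c : ℝ, 0 < c ∧ ∀ᶠ x in 𝓝 x₀, x ∈ C i → ∃ z ∈ effDom g, A z = A x₀ ∧
      G z = 0 ∧ c * ‖x - z‖ ^ 2 ≤ ‖A (x - x₀)‖ ^ 2 + G x := by
    intro i
    by_cases hxi : x₀ ∈ C i
    swap
    · refine ⟨1, one_pos, ?_⟩
      filter_upwards [(hC i).isClosed.isOpen_compl.mem_nhds hxi] with x hx hmem
      exact absurd hmem hx
    have hsub : C i ⊆ effDom g := hdom ▸ subset_iUnion C i
    have hvali := hval i
    obtain ⟨k, b, β, hCi⟩ := hC i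
    have hmem : ∀ x, (∀ j, innerSL ℝ (b j) x ≤ β j) ↔ x ∈ C i := by
      intro x; rw [hCi]; rfl
    have hset : {x | ∀ j, innerSL ℝ (b j) x ≤ β j} = C i := Set.ext hmem
    have hCconv : Convex ℝ (C i) := by
      rw [← hset, ofPred_forall]
      exact convex_iInter fun j => convex_halfSpace_le (innerSL ℝ (b j)).toLinearMap.isLinear _
    obtain ⟨c, hc, hgrow⟩ := exists_quadratic_growth_on_polyhedron (fun j => innerSL ℝ (b j)) β A
      x₀ ((hmem x₀).2 hxi) (LinearMap.toContinuousLinearMap (Q i).toEuclideanLin)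
      (fun x y => by
        have := (Matrix.isSymmetric_toEuclideanLin_iff (A := Q i)).2 (by
          rw [Matrix.IsHermitian, Matrix.conjTranspose_eq_transpose_of_trivial]; exact hQ i)
        exact this x y)
      (innerSL ℝ (a i) + l) (α i - (g x₀).toReal - l x₀) G
      (fun x hx => by
        simp only [hG, hvali x ((hmem x).1 hx), EReal.toReal_coe, map_sub, _root_.add_apply,
          innerSL_apply_apply, LinearMap.coe_toContinuousLinearMap']
        ring)
      (by
        rw [hset]
        have h1 : ConvexOn ℝ (C i) fun x => (g x).toReal := hgconv.subset hsub hCconv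
        have h2 : ConvexOn ℝ (C i) l := l.toLinearMap.convexOn hCconv
        refine ((h1.add h2).add_const (-(g x₀).toReal - l x₀)).congr fun x _ => ?_
        simp only [hG, map_sub, Pi.add_apply]
        ring)
      (fun x hx => hmin x (hsub ((hmem x).1 hx)))
      (by simp [hG])
    refine ⟨c, hc, ?_⟩
    filter_upwards [Metric.closedBall_mem_nhds x₀ one_pos] with x hx hxC
    obtain ⟨z, hz, h⟩ := hgrow x ((hmem x).2 hxC) (by simpa [dist_eq_norm] using hx)
    exact ⟨z, hsub ((hmem z).1 hz), h⟩
  choose c hc hgrow using key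
  obtain ⟨i₁, hi₁⟩ : ∃ i, x₀ ∈ C i := by rwa [hdom, mem_iUnion] at hx₀
  obtain ⟨i₀, -, hi₀⟩ := Finset.exists_min_image Finset.univ c ⟨i₁, Finset.mem_univ _⟩
  refine ⟨c i₀, hc i₀, ?_⟩
  filter_upwards [eventually_all.2 hgrow] with x hx hxg
  rw [hdom, mem_iUnion] at hxg
  obtain ⟨i, hi⟩ := hxg
  obtain ⟨z, hz, h1, h2, h3⟩ := hx i hi
  exact ⟨z, hz, h1, h2,
    (mul_le_mul_of_nonneg_right (hi₀ i (Finset.mem_univ i)) (by positivity)).trans h3⟩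

/-! ### Strong convexity and sums of extended-real functions -/

theorem StrongConvexOn.add_fderiv_add_le {E : Type*} [NormedAddCommGroup E]
    [InnerProductSpace ℝ E] {K : Set E} {σ : ℝ} {φ : E → ℝ} (hφ : StrongConvexOn K σ φ)
    {D : E →L[ℝ] ℝ} {x y : E} (hx : x ∈ K) (hy : y ∈ K) (hD : HasFDerivAt φ D x) :
    φ x + D (y - x) + σ / 2 * ‖y - x‖ ^ 2 ≤ φ y := by
  have hder : HasDerivAt (fun t : ℝ => φ (x + t • (y - x))) (D (y - x)) 0 := hD.hasLineDerivAt _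
  have := hder.le_of_eventually_le (a := φ y - φ x - σ / 2 * ‖y - x‖ ^ 2)
    (b := σ / 2 * ‖y - x‖ ^ 2) (by
      filter_upwards [Ioo_mem_nhdsGT (zero_lt_one' ℝ)] with t ht
      have h1 := hφ.2 hx hy (sub_nonneg.2 ht.2.le) ht.1.le (by ring)
      have e : x + t • (y - x) = (1 - t) • x + t • y := by
        rw [sub_smul, one_smul, smul_sub]; abel
      simp only [e, zero_smul, smul_eq_mul, norm_sub_rev x y, add_zero] at h1 ⊢
      linarith)
  linarith

theorem lt_top_of_add_coe_add_lt_top {u v : EReal} {r : ℝ} (hu : u ≠ ⊥) (hv : v ≠ ⊥)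
    (h : u + (r : EReal) + v < ⊤) : u < ⊤ ∧ v < ⊤ := by
  induction u <;> induction v <;> simp_all

theorem IsConvexFun.comp_linear_add_inner_add {n m : ℕ} {h : EuclideanSpace ℝ (Fin m) → EReal}
    {g : EuclideanSpace ℝ (Fin n) → EReal} (hh : IsConvexFun h) (hg : IsConvexFun g)
    (hhbot : ∀ y, h y ≠ ⊥) (hgbot : ∀ x, g x ≠ ⊥)
    (A : EuclideanSpace ℝ (Fin n) →ₗ[ℝ] EuclideanSpace ℝ (Fin m))
    (q : EuclideanSpace ℝ (Fin n)) :
    IsConvexFun fun x => h (A x) + ((inner ℝ q x : ℝ) : EReal) + g x := by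
  rintro ⟨x, r⟩ hx ⟨y, s⟩ hy a b ha hb hab
  simp only [mem_ofPred_eq] at hx hy
  obtain ⟨hx1, hx2⟩ := lt_top_of_add_coe_add_lt_top (hhbot _) (hgbot _)
    (hx.trans_lt (EReal.coe_lt_top _))
  obtain ⟨hy1, hy2⟩ := lt_top_of_add_coe_add_lt_top (hhbot _) (hgbot _)
    (hy.trans_lt (EReal.coe_lt_top _))
  have e1 := EReal.coe_toReal hx1.ne (hhbot _)
  have e2 := EReal.coe_toReal hx2.ne (hgbot _)
  have e3 := EReal.coe_toReal hy1.ne (hhbot _)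
  have e4 := EReal.coe_toReal hy2.ne (hgbot _)
  have k1 := hh.le_combo e1.ge e3.ge ha hb hab
  have k2 := hg.le_combo e2.ge e4.ge ha hb hab
  rw [← e1, ← e2, ← EReal.coe_add, ← EReal.coe_add, EReal.coe_le_coe_iff] at hx
  rw [← e3, ← e4, ← EReal.coe_add, ← EReal.coe_add, EReal.coe_le_coe_iff] at hy
  simp only [mem_ofPred_eq, Prod.smul_mk, Prod.mk_add_mk, map_add, map_smul, smul_eq_mul]
  refine (add_le_add (add_le_add k1 le_rfl) k2).trans ?_
  rw [← EReal.coe_add, ← EReal.coe_add, EReal.coe_le_coe_iff, inner_add_right,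
    real_inner_smul_right, real_inner_smul_right]
  have := mul_le_mul_of_nonneg_left hx ha
  have := mul_le_mul_of_nonneg_left hy hb
  linarith

theorem LowerSemicontinuous.add_of_ne_bot {X : Type*} [TopologicalSpace X] {u v : X → EReal}
    (hu : LowerSemicontinuous u) (hv : LowerSemicontinuous v) (hubot : ∀ x, u x ≠ ⊥)
    (hvbot : ∀ x, v x ≠ ⊥) : LowerSemicontinuous fun x => u x + v x :=
  hu.add' hv fun x => EReal.continuousAt_add (Or.inr (hvbot x)) (Or.inl (hubot x))

/-! ### The KL inequality -/

/-- Quadratic growth of an objective with respect to its minimizers gives the error bound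
underlying the KL inequality with exponent `1/2`. -/
theorem one_le_mul_infEDist_limitingSubdifferential {d : ℕ}
    {φ : EuclideanSpace ℝ (Fin d) → EReal} (hφ : IsConvexFun φ) {c v : ℝ} (hc : 0 < c)
    {x z : EuclideanSpace ℝ (Fin d)} (hz : φ z = v) (hvx : (v : EReal) < φ x) (hx : φ x < ⊤)
    (hgrow : c * ‖x - z‖ ^ 2 ≤ (φ x).toReal - v) :
    1 ≤ ENNReal.ofReal (√(c⁻¹) * (φ x - v).toReal ^ (-(1 / 2) : ℝ)) *
      Metric.infEDist 0 (limitingSubdifferential φ x) := by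
  have hsub := fun ξ hξ => hφ.toReal_add_inner_le_of_mem_limitingSubdifferential
    (x := x) (ξ := ξ) hξ hz
  have hbot : φ x ≠ ⊥ := (bot_le.trans_lt hvx).ne'
  lift φ x to ℝ using ⟨hx.ne, hbot⟩ with r hr
  rw [EReal.coe_lt_coe_iff] at hvx
  simp only [EReal.toReal_coe, ← EReal.coe_sub] at hgrow hsub ⊢
  set D := r - v with hD
  have hDpos : 0 < D := sub_pos.2 hvx
  have hpow : D ^ (-(1 / 2) : ℝ) = (√D)⁻¹ := by
    rw [Real.rpow_neg hDpos.le, ← Real.sqrt_eq_rpow]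
  have hκ : 0 < √(c⁻¹) * (√D)⁻¹ := by positivity
  have hle : ENNReal.ofReal (√(c⁻¹) * (√D)⁻¹)⁻¹ ≤
      Metric.infEDist 0 (limitingSubdifferential φ x) := by
    refine Metric.le_infEDist.2 fun ξ hξ => ?_
    rw [edist_dist, dist_zero_left]
    refine ENNReal.ofReal_le_ofReal ?_
    have h1 : D ≤ ‖ξ‖ * ‖x - z‖ := by
      have h2 := hsub ξ hξ
      have h3 := real_inner_le_norm ξ (x - z)
      have h4 : inner ℝ ξ (z - x) = -inner ℝ ξ (x - z) := by rw [← inner_neg_right, neg_sub]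
      linarith
    have h2 : c * D ≤ ‖ξ‖ ^ 2 := by
      have h3 : D ^ 2 ≤ ‖ξ‖ ^ 2 * ‖x - z‖ ^ 2 := by
        rw [← mul_pow]; exact pow_le_pow_left₀ hDpos.le h1 2
      have h4 : D * (c * D) ≤ D * ‖ξ‖ ^ 2 := by
        have := mul_le_mul_of_nonneg_left hgrow (sq_nonneg ‖ξ‖)
        nlinarith
      exact le_of_mul_le_mul_left h4 hDpos
    rw [mul_inv, inv_inv, Real.sqrt_inv, inv_inv, ← Real.sqrt_mul hc.le]
    exact Real.sqrt_le_iff.2 ⟨norm_nonneg _, h2⟩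
  rw [hpow]
  calc (1 : ENNReal) = ENNReal.ofReal (√(c⁻¹) * (√D)⁻¹) *
        ENNReal.ofReal (√(c⁻¹) * (√D)⁻¹)⁻¹ := by
        rw [← ENNReal.ofReal_mul hκ.le, mul_inv_cancel₀ hκ.ne', ENNReal.ofReal_one]
    _ ≤ _ := by gcongr

theorem proposition5p2 {n : ℕ} (f g : EuclideanSpace ℝ (Fin n) → EReal)
    (hf : StructuredAssumption f)
    (hg_convex : IsConvexFun g) (hg_plq : IsPiecewiseLinearQuadratic g)
    (xbar : EuclideanSpace ℝ (Fin n))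
    (hxbar : IsOptimalSolution (fun x => f x + g x) xbar) :
    HasKLPropertyHalf (fun x => f x + g x) xbar := by
  obtain ⟨m, A, q, h, ⟨hhbot, -⟩, hlsc, hhconv, hopen, hdiff, hstrong, hfeq⟩ := hf
  obtain rfl : f = fun x => h (A.toEuclideanLin x) + ((inner ℝ q x : ℝ) : EReal) := funext hfeq
  have hgbot := hg_plq.ne_bot
  set B : EuclideanSpace ℝ (Fin n) →L[ℝ] EuclideanSpace ℝ (Fin m) :=
    LinearMap.toContinuousLinearMap A.toEuclideanLin with hB
  have hBA : ∀ x, A.toEuclideanLin x = B x := fun x => rfl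
  have hFconv := hhconv.comp_linear_add_inner_add hg_convex hhbot hgbot A.toEuclideanLin q
  simp only [hBA] at hxbar hFconv ⊢
  set F : EuclideanSpace ℝ (Fin n) → EReal :=
    fun x => h (B x) + ((inner ℝ q x : ℝ) : EReal) + g x with hF
  have hfbot : ∀ x, h (B x) + ((inner ℝ q x : ℝ) : EReal) ≠ ⊥ := fun x => by
    simp [EReal.add_eq_bot_iff, hhbot]
  have hFbot : ∀ x, F x ≠ ⊥ := fun x => by simp [hF, EReal.add_eq_bot_iff, hhbot, hgbot]
  have hdom : ∀ x, F x < ⊤ → B x ∈ effDom h ∧ x ∈ effDom g := fun x hx =>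
    lt_top_of_add_coe_add_lt_top (hhbot _) (hgbot _) hx
  have hFval : ∀ x, B x ∈ effDom h → x ∈ effDom g →
      F x = (((h (B x)).toReal + inner ℝ q x + (g x).toReal : ℝ) : EReal) := by
    intro x hx1 hx2
    rw [EReal.coe_add, EReal.coe_add, EReal.coe_toReal (ne_of_lt hx1) (hhbot _),
      EReal.coe_toReal (ne_of_lt hx2) (hgbot _)]
  obtain ⟨hFx₀, hmin⟩ := hxbar
  obtain ⟨hB₀, hg₀⟩ := hdom xbar hFx₀
  have hgconv := hg_convex.convexOn_toReal hgbot
  have hd : HasFDerivAt (fun y => (h y).toReal) (fderiv ℝ (fun y => (h y).toReal) (B xbar))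
      (B xbar) :=
    ((hdiff.contDiffAt (hopen.mem_nhds hB₀)).differentiableAt one_ne_zero).hasFDerivAt
  set D := fderiv ℝ (fun y => (h y).toReal) (B xbar)
  set l : EuclideanSpace ℝ (Fin n) →L[ℝ] ℝ := D ∘L B + innerSL ℝ q with hl
  have hlval : ∀ x, l x = D (B x) + inner ℝ q x := fun x => rfl
  have hcontB : ∀ S ∈ 𝓝 (B xbar), ∀ᶠ x in 𝓝 xbar, B x ∈ S := fun S hS =>
    B.continuous.continuousAt.eventually_mem hS
  -- First-order optimality: move from `xbar` towards `x`, bound `g` by its chord, and compare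
  -- slopes at zero. Openness of `dom h` keeps small steps admissible.
  have hopt : ∀ x ∈ effDom g, 0 ≤ (g x).toReal - (g xbar).toReal + l (x - xbar) := by
    intro x hx
    have hder : HasDerivAt (fun t : ℝ => -(h (B xbar + t • B (x - xbar))).toReal)
        (-D (B (x - xbar))) 0 := HasDerivAt.neg (hd.hasLineDerivAt (B (x - xbar)))
    have hnear : ∀ᶠ t : ℝ in 𝓝[>] 0, B (xbar + t • (x - xbar)) ∈ effDom h := by
      have hc : Continuous fun t : ℝ => B (xbar + t • (x - xbar)) := by fun_prop
      exact (hc.continuousAt.eventually_mem (by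
        simpa using hopen.mem_nhds hB₀)).filter_mono nhdsWithin_le_nhds
    have := hder.le_of_eventually_le
      (a := (g x).toReal - (g xbar).toReal + inner ℝ q (x - xbar)) (b := 0) (by
        filter_upwards [hnear, Ioo_mem_nhdsGT (zero_lt_one' ℝ)] with t ht ht1
        have e : xbar + t • (x - xbar) = (1 - t) • xbar + t • x := by
          rw [sub_smul, one_smul, smul_sub]; abel
        have h1 := hgconv.2 hg₀ hx (sub_nonneg.2 ht1.2.le) ht1.1.le (by ring)
        have h2 := hgconv.1 hg₀ hx (sub_nonneg.2 ht1.2.le) ht1.1.le (by ring)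
        have h3 := hmin (xbar + t • (x - xbar))
        rw [hFval _ hB₀ hg₀, hFval _ ht (e ▸ h2), EReal.coe_le_coe_iff] at h3
        rw [← e] at h1
        simp only [map_add, map_smul, inner_add_right, real_inner_smul_right, smul_eq_mul,
          zero_smul, add_zero] at h1 h3 ⊢
        linarith)
    rw [hlval]
    linarith
  obtain ⟨c, hc, hgrow⟩ := hg_plq.exists_quadratic_growth hg_convex B l xbar hg₀ hopt
  obtain ⟨r, hr, hrsub⟩ := Metric.nhds_basis_closedBall.mem_iff.1 (hopen.mem_nhds hB₀)
  obtain ⟨σ, hσ, hsc⟩ := hstrong _ hrsub (isCompact_closedBall _ _) (convex_closedBall _ _)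
  refine ⟨⟨hFbot, xbar, hFx₀⟩, ?_, hFx₀, ?_⟩
  · refine LowerSemicontinuous.add_of_ne_bot ?_ hg_plq.lowerSemicontinuous hfbot hgbot
    refine LowerSemicontinuous.add_of_ne_bot (hlsc.comp B.continuous) ?_
      (fun x => hhbot _) fun x => EReal.coe_ne_bot _
    exact (continuous_coe_real_ereal.comp (by fun_prop)).lowerSemicontinuous
  -- Chosen so that `σ/2 ‖B (x - xbar)‖² + G x ≥ μ (‖B (x - xbar)‖² + G x)`.
  set μ := min (σ / 2) 1 with hμ
  have hμ0 : 0 < μ := lt_min (by positivity) one_pos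
  obtain ⟨ε, hε, hball⟩ := Metric.eventually_nhds_iff_ball.1
    (hgrow.and (hcontB _ (Metric.closedBall_mem_nhds _ hr)))
  refine ⟨√((μ * c)⁻¹), by positivity, ε, hε, fun x hx hlt htop => ?_⟩
  obtain ⟨hx1, hx2⟩ := hball x hx
  obtain ⟨hBx, hgx⟩ := hdom x htop
  obtain ⟨z, hzg, hBz, hz0, hzle⟩ := hx1 hgx
  -- Since `B z = B xbar`, the `h` term is unchanged and `l (z - xbar)` reduces to `⟪q, z - xbar⟫`,
  -- so the linearized equality is exact.
  have hzF : F z = F xbar := by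
    rw [hFval z (hBz ▸ hB₀) hzg, hFval xbar hB₀ hg₀, hBz]
    rw [hlval, map_sub, hBz, sub_self, map_zero, inner_sub_right] at hz0
    congr 1
    linarith
  have hF₀ := hFval xbar hB₀ hg₀
  rw [hF₀] at hzF hlt ⊢
  refine one_le_mul_infEDist_limitingSubdifferential hFconv (mul_pos hμ0 hc) hzF hlt htop ?_
  have hlow := hsc.add_fderiv_add_le (Metric.mem_closedBall_self hr.le) hx2 hd
  rw [← map_sub] at hlow
  change _ ≤ (F x).toReal - _
  rw [hFval x hBx hgx, EReal.toReal_coe]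
  have hG := hopt x hgx
  have h1 := mul_le_mul_of_nonneg_left hzle hμ0.le
  have h2 : μ * ‖B (x - xbar)‖ ^ 2 ≤ σ / 2 * ‖B (x - xbar)‖ ^ 2 :=
    mul_le_mul_of_nonneg_right (min_le_left _ _) (sq_nonneg _)
  have h3 := mul_le_of_le_one_left hG (min_le_right (σ / 2) 1)
  rw [← hμ] at h3
  have h4 := hlval (x - xbar)
  rw [inner_sub_right] at h4
  linarith
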